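/- Let $n\ge 0$ and identify $X\in\mathcal M_{n\times n}(\mathbb R)$, with rows $\mathbf x_1,\dots,\mathbf x_n$, with $\tilde{\mathbf x}=\mathcal I(X)=(\mathbf x_1,\dots,\mathbf x_n)\in\mathbb R^{n^2}$, with canonical basis $\tilde{\mathbf e}_{ij}$. Let $\mathcal O(n)=\mathcal I(\mathbf O(n))$, and put $F_s(\tilde{\mathbf x})=\tfrac12\|\mathbf x_s\|^2$ ($1\le s\le n$) and $F_{pq}(\tilde{\mathbf x})=\langle\mathbf x_p,\mathbf x_q\rangle$ ($1\le p<q\le n$). Let $G_{\mathbf O(n)}:\mathbf O(n)\to\mathbb R$ be a $C^2$ cost function, $G_{\mathcal O(n)}$ the corresponding function on $\mathcal O(n)$, and $G:\mathbb R^{n^2}\to\mathbb R$ any $C^2$ prolongation of it. Write $\frac{\partial G}{\partial\mathbf x_i}=\sum_j\frac{\partial G}{\partial x_{ij}}\mathbf e_j\in\mathbb R^n$. 1. $\mathcal O(n)$ is the level set $\{F_s=\tfrac12\ \forall s,\ F_{pq}=0\ \forall p<q\}$, and the gradients of all $F_s,F_{pq}$ are linearly independent at each of its points (regular value). 2. Give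 $\mathcal O(n)$ the Riemannian metric induced from $\mathbb R^{n^2}$. Its Levi-Civita connection is $\nabla^S_\eta\xi=\mathbf P_{T_{\tilde{\mathbf x}}\mathcal O(n)}(D_\eta\xi)$ ($\mathbf P$ the orthogonal projection, $D_\eta$ the derivative along $\mathcal O(n)$ in direction $\eta$). The function $G_{\mathcal O(n)}$ and its Riemannian gradient are differentiable along $\mathcal O(n)$. Let $\mathrm{Hess}\,G_{\mathcal O(n)}(\tilde{\mathbf x})(\eta,\xi)=\langle\nabla^S_\eta\,\mathrm{grad}\,G_{\mathcal O(n)},\xi\rangle$ for $\eta,\xi\in T_{\tilde{\mathbf x}}\mathcal O(n)$. On $\mathbb R^{n^2}$, $\mathrm{Hess}$ denotes the second derivative. 3. List the constraints as $(F_i)_{i=1}^k$, and let $\Sigma^{(f_1,\dots,f_k)}_{(g_1,\dots,g_k)}$ be the matrix with entry $\langle\mathrm{grad}\,g_j,\mathrm{grad}\,f_i\rangle$ in row $i$ and column $j$. At every $\tilde{\mathbf x}\in\mathcal O(n)$ one has $\det\Sigma^{(F_1,\dots,F_k)}_{(F_1,\dots,F_k)}\ne0$, and the multipliers $$\sigma_i=\frac{\det\Sigma^{(F_1,\dots,F_k)}_{(F_1,\dots,F_{i-1},G,F_{i+1},\dots,F_k)}}{\det\Sigma^{(F_1,\dots,F_k)}_{(F_1,\dots,F_k)}}$$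 are $$\sigma_s=\Big\langle\tfrac{\partial G}{\partial\mathbf x_s},\mathbf x_s\Big\rangle,\qquad \sigma_{pq}=\tfrac12\Big(\Big\langle\tfrac{\partial G}{\partial\mathbf x_p},\mathbf x_q\Big\rangle+\Big\langle\tfrac{\partial G}{\partial\mathbf x_q},\mathbf x_p\Big\rangle\Big).$$ 4. At every $\tilde{\mathbf x}\in\mathcal O(n)$ and for all $\eta,\xi\in T_{\tilde{\mathbf x}}\mathcal O(n)$, with these values of $\sigma_s,\sigma_{pq}$, $$\mathrm{Hess}\,G_{\mathcal O(n)}(\eta,\xi)=\mathrm{Hess}\,G(\eta,\xi)-\sum_{s}\sigma_s\,\mathrm{Hess}\,F_s(\eta,\xi)-\sum_{p<q}\sigma_{pq}\,\mathrm{Hess}\,F_{pq}(\eta,\xi),$$ which in coordinates equals $$\sum_{a,b,c,d}\tfrac{\partial^2G}{\partial x_{ab}\partial x_{cd}}\eta_{ab}\xi_{cd}-\sum_{i,j,s}x_{si}\tfrac{\partial G}{\partial x_{si}}\eta_{sj}\xi_{sj}-\tfrac12\sum_{p<q}\sum_{i,j}\Big(x_{qi}\tfrac{\partial G}{\partial x_{pi}}+x_{pi}\tfrac{\partial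 G}{\partial x_{qi}}\Big)(\eta_{pj}\xi_{qj}+\eta_{qj}\xi_{pj}).$$ 5. Let $\Omega_{\alpha\beta}=(-1)^{\alpha+\beta}(\mathbf e_\alpha\otimes\mathbf e_\beta-\mathbf e_\beta\otimes\mathbf e_\alpha)$, $\alpha<\beta$, where $\mathbf e_\alpha\otimes\mathbf e_\beta$ is the matrix with $1$ in row $\alpha$, column $\beta$ and $0$ elsewhere. At every $\tilde{\mathbf x}=\mathcal I(X)\in\mathcal O(n)$ the vectors $\tilde\omega_{\alpha\beta}=\mathcal I(X\Omega_{\alpha\beta})=(-1)^{\alpha+\beta}\sum_i(x_{i\alpha}\tilde{\mathbf e}_{i\beta}-x_{i\beta}\tilde{\mathbf e}_{i\alpha})$, $\alpha<\beta$, form a basis of $T_{\tilde{\mathbf x}}\mathcal O(n)$. In this basis, for $\gamma<\tau$ and $\alpha<\beta$, with $\epsilon=(-1)^{\alpha+\beta+\gamma+\tau}$, the Hessian matrix has the entries $$\begin{aligned} &[\mathrm{Hess}\,G_{\mathcal O(n)}(\tilde{\mathbf x})]_{(\gamma\tau)(\alpha\beta)}=\epsilon\sum_{a,c}\Big(x_{a\gamma}x_{c\alpha}\tfrac{\partial^2G}{\partial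 x_{a\tau}\partial x_{c\beta}}-x_{a\gamma}x_{c\beta}\tfrac{\partial^2G}{\partial x_{a\tau}\partial x_{c\alpha}}-x_{a\tau}x_{c\alpha}\tfrac{\partial^2G}{\partial x_{a\gamma}\partial x_{c\beta}}+x_{a\tau}x_{c\beta}\tfrac{\partial^2G}{\partial x_{a\gamma}\partial x_{c\alpha}}\Big)\\ &-\epsilon\sum_{i,s}x_{si}\big(x_{s\tau}x_{s\beta}\delta_{\gamma\alpha}-x_{s\gamma}x_{s\beta}\delta_{\tau\alpha}-x_{s\tau}x_{s\alpha}\delta_{\gamma\beta}+x_{s\gamma}x_{s\alpha}\delta_{\tau\beta}\big)\tfrac{\partial G}{\partial x_{si}}\\ &-\tfrac\epsilon2\sum_{p<q}\sum_i\Big(x_{qi}\tfrac{\partial G}{\partial x_{pi}}+x_{pi}\tfrac{\partial G}{\partial x_{qi}}\Big)\big(x_{p\tau}x_{q\beta}\delta_{\gamma\alpha}-x_{p\gamma}x_{q\beta}\delta_{\tau\alpha}-x_{p\tau}x_{q\alpha}\delta_{\gamma\beta}+x_{p\gamma}x_{q\alpha}\delta_{\tau\beta}\\ &\qquad+x_{q\tau}x_{p\beta}\delta_{\gamma\alpha}-x_{q\gamma}x_{p\beta}\delta_{\tau\alpha}-x_{q\tau}x_{p\alpha}\delta_{\gamma\beta}+x_{q\gamma}x_{p\alpha}\delta_{\tau\beta}\big).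 \end{aligned}$$ -/

import Mathlib

open scoped BigOperators

noncomputable section

/-! ### Riemannian geometry of a subset of a Euclidean space -/

section Submanifold

variable {E : Type*} [NormedAddCommGroup E] [InnerProductSpace ℝ E] [FiniteDimensional ℝ E]

/-- The tangent space of `S ⊆ E` at `x`: the span of Mathlib's tangent cone. For an embedded `C¹`
submanifold the tangent cone is already a linear subspace, the usual tangent space. It carries the
induced inner product. -/
def TangentSpaceAt (S : Set E) (x : E) : Submodule ℝ E :=
  Submodule.span ℝ (tangentConeAt ℝ S x)

/-- A differentiable tangent vector field on `S`, represented by a map on `E` of which only the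
values on `S` matter. -/
def IsTangentField (S : Set E) (ξ : E → E) : Prop :=
  DifferentiableOn ℝ ξ S ∧ ∀ x ∈ S, ξ x ∈ TangentSpaceAt S x

/-- The covariant derivative `∇^S ξ` at `x` of a vector field `ξ` along `S` for the induced metric,
`η ↦ P_{T_x S} (D_η ξ)`, where `P_{T_x S}` is the orthogonal projection. The derivative within `S`
of a map that is differentiable within `S` is well determined on tangent vectors, where it equals
the derivative of any differentiable prolongation. -/
def covDeriv (S : Set E) (ξ : E → E) (x : E) :
    TangentSpaceAt S x →ₗ[ℝ] TangentSpaceAt S x :=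
  ((TangentSpaceAt S x).orthogonalProjectionOnto ∘L fderivWithin ℝ ξ S x ∘L
    (TangentSpaceAt S x).subtypeL : TangentSpaceAt S x →L[ℝ] TangentSpaceAt S x)

/-- The defining properties of the Levi-Civita connection of the metric induced on `S`. -/
structure IsLeviCivita (S : Set E)
    (conn : (E → E) → (x : E) → TangentSpaceAt S x →ₗ[ℝ] TangentSpaceAt S x) : Prop where
  /-- it depends only on the field along `S` -/
  congr : ∀ ξ ζ : E → E, IsTangentField S ξ → IsTangentField S ζ → Set.EqOn ξ ζ S →
    ∀ x ∈ S, conn ξ x = conn ζ x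
  /-- additivity -/
  add : ∀ ξ ζ : E → E, IsTangentField S ξ → IsTangentField S ζ →
    ∀ x ∈ S, conn (fun y => ξ y + ζ y) x = conn ξ x + conn ζ x
  /-- the Leibniz rule -/
  leibniz : ∀ (f : E → ℝ) (ξ : E → E), DifferentiableOn ℝ f S → IsTangentField S ξ →
    ∀ x ∈ S, ∀ η : TangentSpaceAt S x,
      (conn (fun y => f y • ξ y) x η : E)
        = fderivWithin ℝ f S x (η : E) • ξ x + f x • (conn ξ x η : E)
  /-- compatibility with the induced metric -/
  metric : ∀ ξ ζ : E → E, IsTangentField S ξ → IsTangentField S ζ →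
    ∀ x ∈ S, ∀ η : TangentSpaceAt S x,
      fderivWithin ℝ (fun y => inner ℝ (ξ y) (ζ y)) S x (η : E)
        = inner ℝ (conn ξ x η : E) (ζ x) + inner ℝ (ξ x) (conn ζ x η : E)
  /-- vanishing torsion -/
  torsionFree : ∀ ξ ζ : E → E, ∀ hξ : IsTangentField S ξ, ∀ hζ : IsTangentField S ζ,
    ∀ x, ∀ hx : x ∈ S,
      (conn ζ x ⟨ξ x, hξ.2 x hx⟩ : E) - (conn ξ x ⟨ζ x, hζ.2 x hx⟩ : E)
        = VectorField.lieBracketWithin ℝ ξ ζ S x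

/-- The Riemannian gradient on `S` of a function `f` for the induced metric: the vector of `T_x S`
that represents the differential of `f` along `S`. Only the values of `f` on `S` matter. -/
def riemGradient (S : Set E) (f : E → ℝ) (x : E) : E :=
  (TangentSpaceAt S x).orthogonalProjectionOnto (gradientWithin f S x)

/-- The Hessian operator `η ↦ ∇^S_η grad f` on `T_x S`. -/
def hessianOperator (S : Set E) (f : E → ℝ) (x : E) :
    TangentSpaceAt S x →ₗ[ℝ] TangentSpaceAt S x :=
  covDeriv S (riemGradient S f) x

/-- The covariant tensor `Hess f (x) (η, ξ) = ⟨H(x) η, ξ⟩` of the Hessian operator. -/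
def hessianForm (S : Set E) (f : E → ℝ) (x : E) (η ξ : TangentSpaceAt S x) : ℝ :=
  inner ℝ (hessianOperator S f x η : E) (ξ : E)

/-- The Hessian of a function on the ambient Euclidean space: its second derivative. -/
def ambientHessian (f : E → ℝ) (x η ξ : E) : ℝ :=
  fderiv ℝ (fun y => fderiv ℝ f y) x η ξ

/-- The Gramian matrix with entry `⟨grad g_j, grad f_i⟩` in row `i`, column `j`. -/
def gramian {ι : Type*} (f g : ι → E → ℝ) (x : E) : Matrix ι ι ℝ :=
  Matrix.of fun i j => inner ℝ (gradient (g j) x) (gradient (f i) x)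

/-- The multiplier functions
`σ_i = det Σ_{(F_1, …, G, …, F_k)}^{(F_1, …, F_k)} / det Σ_{(F_1, …, F_k)}^{(F_1, …, F_k)}`,
with `G` in place of `F_i` in the numerator. -/
def multiplier {ι : Type*} [Fintype ι] [DecidableEq ι] (F : ι → E → ℝ) (G : E → ℝ) (i : ι)
    (x : E) : ℝ :=
  (gramian F (Function.update F i G) x).det / (gramian F F x).det

end Submanifold

/-! ### The orthogonal group in `ℝ^{n²}` -/

/-- The Euclidean space `ℝ^{n²}` with coordinates `x_{ij}`. -/
abbrev EucMat (n : ℕ) : Type := EuclideanSpace ℝ (Fin n × Fin n)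

/-- The linear identification `ℐ` of `n × n` matrices with vectors of `ℝ^{n²}`. -/
def matVec (n : ℕ) : Matrix (Fin n) (Fin n) ℝ ≃ₗ[ℝ] EucMat n where
  toFun X := WithLp.toLp 2 fun ij => X ij.1 ij.2
  invFun x := Matrix.of fun i j => x (i, j)
  left_inv _ := rfl
  right_inv _ := rfl
  map_add' _ _ := rfl
  map_smul' _ _ := rfl

/-- `𝒪(n) = ℐ(O(n))`. -/
def orthSet (n : ℕ) : Set (EucMat n) :=
  matVec n '' (Matrix.orthogonalGroup (Fin n) ℝ : Set (Matrix (Fin n) (Fin n) ℝ))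

/-- A function on `O(n)` as a function on `𝒪(n)`, with the irrelevant value `0` outside `𝒪(n)`. -/
def onOrthSet {n : ℕ} (g : Matrix.orthogonalGroup (Fin n) ℝ → ℝ) : EucMat n → ℝ :=
  Function.extend
    (fun X : Matrix.orthogonalGroup (Fin n) ℝ => matVec n (X : Matrix (Fin n) (Fin n) ℝ)) g 0

/-- The canonical basis vector `ẽ_{ij}`. -/
def eVec {n : ℕ} (i j : Fin n) : EucMat n := EuclideanSpace.single (i, j) (1 : ℝ)

/-- The `i`-th row `x_i ∈ ℝⁿ`. -/
def rowVec {n : ℕ} (x : EucMat n) (i : Fin n) : EuclideanSpace ℝ (Fin n) :=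
  WithLp.toLp 2 fun j => x (i, j)

/-- The partial derivative `∂G/∂x_{ij}`. -/
def partialD {n : ℕ} (G : EucMat n → ℝ) (i j : Fin n) (x : EucMat n) : ℝ :=
  fderiv ℝ G x (eVec i j)

/-- The vector `∂G/∂x_i = ∑_j (∂G/∂x_{ij}) e_j` of `ℝⁿ`. -/
def partialRow {n : ℕ} (G : EucMat n → ℝ) (i : Fin n) (x : EucMat n) :
    EuclideanSpace ℝ (Fin n) :=
  WithLp.toLp 2 fun j => partialD G i j x

/-- The second partial derivative `∂²G/∂x_{ab}∂x_{cd}`. -/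
def partialD2 {n : ℕ} (G : EucMat n → ℝ) (a b c d : Fin n) (x : EucMat n) : ℝ :=
  partialD (partialD G c d) a b x

/-- The index pairs `p < q`. -/
abbrev UpperPair (n : ℕ) : Type := {p : Fin n × Fin n // p.1 < p.2}

/-- The constraint function `F_s = ½ ‖x_s‖²`. -/
def normConstraint {n : ℕ} (s : Fin n) (x : EucMat n) : ℝ := 1 / 2 * ‖rowVec x s‖ ^ 2

/-- The constraint function `F_{pq} = ⟨x_p, x_q⟩`. -/
def innerConstraint {n : ℕ} (p q : Fin n) (x : EucMat n) : ℝ := inner ℝ (rowVec x p) (rowVec x q)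

/-- The family of all constraint functions `F_s`, `F_{pq}` with `p < q`. -/
def constraints (n : ℕ) : Fin n ⊕ UpperPair n → EucMat n → ℝ :=
  Sum.elim normConstraint fun pq => innerConstraint pq.1.1 pq.1.2

/-- The skew-symmetric matrix `Ω_{αβ} = (-1)^{α+β} (e_α ⊗ e_β - e_β ⊗ e_α)`. The indices start
at `0` here, which does not change the sign. -/
def skewBasis {n : ℕ} (α β : Fin n) : Matrix (Fin n) (Fin n) ℝ :=
  (-1 : ℝ) ^ ((α : ℕ) + (β : ℕ)) • (Matrix.single α β 1 - Matrix.single β α 1)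

/-- `ω̃_{αβ}(x̃) = ℐ(X Ω_{αβ})`, where `x̃ = ℐ(X)`. -/
def tangentVec {n : ℕ} (x : EucMat n) (α β : Fin n) : EucMat n :=
  matVec n ((matVec n).symm x * skewBasis α β)

/-- The Kronecker symbol. -/
def kron {n : ℕ} (i j : Fin n) : ℝ := if i = j then 1 else 0

end

/-!
Write `S = 𝒪(n)` as the common level set of the constraints `F_i`, i.e. the orthonormality relations
between the rows. Three facts about the constraints carry the argument.

* The tangent space at `X` is the common kernel of the differentials `dF_i`
  (`mem_tangentSpaceAt_orthSet`). Tangent vectors lie in the kernel since the `F_i` are constant on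
  `S`. Conversely `V` in the kernel means that `K = V Xᵀ` is skew-symmetric, and then
  `V = K X` is the velocity of the curve `exp(tK) X` in `S`.
* The gradients of the `F_i` are pairwise orthogonal along `S`, with squared norms `1` for the
  `F_s` and `2` for the `F_{pq}` (`gramian_constraints`). Hence they are independent, and Cramer's
  rule for a diagonal Gramian matrix (`multiplier_eq_of_orthogonal`) shows that the multipliers are
  `σ_i = ⟨grad G, grad F_i⟩ / ‖grad F_i‖²`.
* The `F_i` are quadratic forms, so their second derivatives are immediate.

The rest holds for any such level set. Derivatives within `S` are determined on the span of the
tangent cone (`HasFDerivWithinAt.fderivWithin_apply_tangent`), so the product rules hold for them in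
tangent directions; the projected derivative is torsion-free because the derivative of the tangency
condition `dF_i(ξ) = 0` involves only the symmetric form `Hess F_i` (`isLeviCivita_covDeriv`). The
Riemannian gradient agrees along `S` with the differentiable field `grad G - ∑ σ_i grad F_i`
(`riemGradient_eq`). Differentiating this field and pairing with a tangent vector, the terms
containing `dσ_i` drop out because `grad F_i` is normal, which leaves
`Hess G - ∑ σ_i Hess F_i` (`hessianForm_eq`).

For the basis, `V = X A` with `A = Xᵀ V` skew-symmetric, and the `Ω_{αβ}` form a basis of the
skew-symmetric matrices. The coordinate formulas follow by bilinear expansion.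
-/

noncomputable section

/-! ### Level sets in a Euclidean space -/

section LevelSet

variable {E : Type*} [NormedAddCommGroup E] [InnerProductSpace ℝ E]
  {S : Set E} {x : E}

/-- The derivative within `S` is determined on the span of the tangent cone, even though it need not
be unique as a linear map on `E`. -/
theorem HasFDerivWithinAt.fderivWithin_apply_tangent {F : Type*} [NormedAddCommGroup F]
    [NormedSpace ℝ F] {f : E → F} {f' : E →L[ℝ] F} (h : HasFDerivWithinAt f f' S x) {v : E}
    (hv : v ∈ TangentSpaceAt S x) : fderivWithin ℝ f S x v = f' v :=
  LinearMap.eqOn_span (f := (fderivWithin ℝ f S x).toLinearMap) (g := f'.toLinearMap)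
    (h.differentiableWithinAt.hasFDerivWithinAt.unique_on h) hv

theorem hasFDerivAt_fderiv {F : Type*} [NormedAddCommGroup F] [NormedSpace ℝ F] {f : E → F}
    (hf : ContDiff ℝ 2 f) (x : E) :
    HasFDerivAt (fderiv ℝ f) (fderiv ℝ (fderiv ℝ f) x) x :=
  ((hf.fderiv_right (m := 1) (by norm_num)).differentiable one_ne_zero x).hasFDerivAt

theorem ambientHessian_comm {F : E → ℝ} (hF : ContDiff ℝ 2 F) (x v w : E) :
    ambientHessian F x v w = ambientHessian F x w v :=
  (hF.contDiffAt.isSymmSndFDerivAt (by simp)) v w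

/-- Differentiating the tangency condition `dF(ξ) = 0` along the level set. -/
theorem fderiv_fderivWithin_tangentField {F : E → ℝ} (hF : ContDiff ℝ 2 F) {ξ : E → E}
    (hξ : DifferentiableOn ℝ ξ S) (hξF : ∀ y ∈ S, fderiv ℝ F y (ξ y) = 0) (hx : x ∈ S) {v : E}
    (hv : v ∈ TangentSpaceAt S x) :
    fderiv ℝ F x (fderivWithin ℝ ξ S x v) = -ambientHessian F x v (ξ x) := by
  have h := (hasFDerivAt_fderiv hF x).hasFDerivWithinAt (s := S) |>.clm_apply
    (hξ x hx).hasFDerivWithinAt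
  have h0 : HasFDerivWithinAt (fun y => fderiv ℝ F y (ξ y)) (0 : E →L[ℝ] ℝ) S x :=
    (hasFDerivWithinAt_const (0 : ℝ) x S).congr hξF (hξF x hx)
  have := (h.fderivWithin_apply_tangent hv).symm.trans (h0.fderivWithin_apply_tangent hv)
  simp at this
  unfold ambientHessian
  linarith

variable [FiniteDimensional ℝ E]

theorem covDeriv_apply (ξ : E → E) (η : TangentSpaceAt S x) :
    covDeriv S ξ x η = (TangentSpaceAt S x).orthogonalProjectionOnto (fderivWithin ℝ ξ S x η) :=
  rfl

theorem inner_covDeriv (ξ : E → E) (η : TangentSpaceAt S x) {v : E}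
    (hv : v ∈ TangentSpaceAt S x) :
    inner ℝ (covDeriv S ξ x η : E) v = inner ℝ (fderivWithin ℝ ξ S x η) v := by
  rw [covDeriv_apply]
  have := Submodule.inner_orthogonalProjectionOnto_eq_of_mem_right (⟨v, hv⟩ : TangentSpaceAt S x)
    (fderivWithin ℝ ξ S x η)
  exact this

/-- The projected derivative is the Levi-Civita connection whenever the tangent spaces are the
common kernels of the differentials of `C²` functions: the bracket of two tangent fields is then
tangent, because second derivatives are symmetric. -/
theorem isLeviCivita_covDeriv {ι : Type*} {F : ι → E → ℝ} (hF : ∀ i, ContDiff ℝ 2 (F i))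
    (hT : ∀ x ∈ S, ∀ v, v ∈ TangentSpaceAt S x ↔ ∀ i, fderiv ℝ (F i) x v = 0) :
    IsLeviCivita S (covDeriv S) where
  congr ξ ζ _ _ h x hx := by
    ext η
    simp only [covDeriv_apply]
    rw [fderivWithin_congr h (h hx)]
  add ξ ζ hξ hζ x hx := by
    ext1 η
    have h := (hξ.1 x hx).hasFDerivWithinAt.add (hζ.1 x hx).hasFDerivWithinAt
    have h' := h.fderivWithin_apply_tangent η.2
    simp only [LinearMap.add_apply, covDeriv_apply, ← map_add]
    exact congrArg _ h'
  leibniz f ξ hf hξ x hx η := by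
    have h := (hf x hx).hasFDerivWithinAt.smul (hξ.1 x hx).hasFDerivWithinAt
    have h' := h.fderivWithin_apply_tangent η.2
    have hp := Submodule.orthogonalProjectionOnto_mem_subspace_eq_self
      (⟨ξ x, hξ.2 x hx⟩ : TangentSpaceAt S x)
    simp only [covDeriv_apply]
    refine (congrArg (fun u => ((TangentSpaceAt S x).orthogonalProjectionOnto u : E)) h').trans ?_
    simp only [add_apply, smul_apply,
      ContinuousLinearMap.smulRight_apply, map_add, map_smul, Submodule.coe_add,
      Submodule.coe_smul]
    rw [show (TangentSpaceAt S x).orthogonalProjectionOnto (ξ x) = ⟨ξ x, hξ.2 x hx⟩ from hp]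
    exact add_comm _ _
  metric ξ ζ hξ hζ x hx η := by
    have h := (hξ.1 x hx).hasFDerivWithinAt.inner ℝ (hζ.1 x hx).hasFDerivWithinAt
    rw [h.fderivWithin_apply_tangent η.2, inner_covDeriv _ _ (hζ.2 x hx),
      real_inner_comm _ (ξ x), inner_covDeriv _ _ (hξ.2 x hx)]
    simp [fderivInnerCLM_apply, real_inner_comm, add_comm]
  torsionFree ξ ζ hξ hζ x hx := by
    -- the bracket is tangent, so the projection does not change it
    have hmem : fderivWithin ℝ ζ S x (ξ x) - fderivWithin ℝ ξ S x (ζ x) ∈ TangentSpaceAt S x := by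
      refine (hT x hx _).2 fun i => ?_
      rw [map_sub,
        fderiv_fderivWithin_tangentField (hF i) hζ.1 (fun y hy => (hT y hy _).1 (hζ.2 y hy) i) hx
          (hξ.2 x hx),
        fderiv_fderivWithin_tangentField (hF i) hξ.1 (fun y hy => (hT y hy _).1 (hξ.2 y hy) i) hx
          (hζ.2 x hx), ambientHessian_comm (hF i)]
      ring
    have hp := Submodule.orthogonalProjectionOnto_mem_subspace_eq_self
      (⟨_, hmem⟩ : TangentSpaceAt S x)
    simp only [covDeriv_apply, ← Submodule.coe_sub, ← map_sub]
    exact congrArg Subtype.val hp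

theorem differentiableAt_gradient {f : E → ℝ} (hf : ContDiff ℝ 2 f) (x : E) :
    DifferentiableAt ℝ (gradient f) x := by
  -- over `ℝ` the conjugate-linear Riesz isomorphism is linear
  let L : StrongDual ℝ E →ₗ[ℝ] E :=
    { toFun := (InnerProductSpace.toDual ℝ E).symm
      map_add' := map_add _
      map_smul' := fun c φ => by simp }
  exact L.toContinuousLinearMap.differentiableAt.comp x (hasFDerivAt_fderiv hf x).differentiableAt

theorem inner_fderiv_gradient {f : E → ℝ} (hf : ContDiff ℝ 2 f) (x v w : E) :
    inner ℝ (fderiv ℝ (gradient f) x v) w = ambientHessian f x v w := by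
  have h1 := (differentiableAt_gradient hf x).hasFDerivAt.inner ℝ (hasFDerivAt_const w x)
  have h2 := (hasFDerivAt_fderiv hf x).clm_apply (hasFDerivAt_const w x)
  simp only [inner_gradient_left] at h1
  simpa [ambientHessian, fderivInnerCLM_apply] using DFunLike.congr_fun (h1.unique h2) v

section Multipliers

variable {ι : Type*} [Fintype ι] {F : ι → E → ℝ} {G f : E → ℝ} {σ : ι → E → ℝ}

/-- The tangent vector `grad G - ∑ σ_i grad F_i` is the Riemannian gradient. -/
theorem riemGradient_eq
    (hT : ∀ v, v ∈ TangentSpaceAt S x ↔ ∀ i, fderiv ℝ (F i) x v = 0)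
    (hG : DifferentiableAt ℝ G x) (hfG : Set.EqOn f G S) (hx : x ∈ S)
    (hσ : gradient G x - ∑ i, σ i x • gradient (F i) x ∈ TangentSpaceAt S x) :
    riemGradient S f x = gradient G x - ∑ i, σ i x • gradient (F i) x := by
  have hf : HasFDerivWithinAt f (fderiv ℝ G x) S x :=
    hG.hasFDerivAt.hasFDerivWithinAt.congr hfG (hfG hx)
  refine Submodule.eq_starProjection_of_mem_of_inner_eq_zero hσ fun w hw => ?_
  have h1 : inner ℝ (gradientWithin f S x) w = fderiv ℝ G x w := by
    rw [← hf.fderivWithin_apply_tangent hw]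
    simp [gradientWithin]
  rw [inner_sub_left, h1, inner_sub_left, sum_inner, inner_gradient_left]
  simp [inner_smul_left, (hT w).1 hw]

/-- Along `S` the Riemannian gradient has the prolongation `grad G - ∑ σ_i grad F_i` to `E`, whose
derivative gives its derivative within `S`. -/
theorem hasFDerivWithinAt_riemGradient
    (hF : ∀ i, ContDiff ℝ 2 (F i))
    (hT : ∀ x ∈ S, ∀ v, v ∈ TangentSpaceAt S x ↔ ∀ i, fderiv ℝ (F i) x v = 0)
    (hG : ContDiff ℝ 2 G) (hfG : Set.EqOn f G S) (hσd : ∀ i, DifferentiableAt ℝ (σ i) x)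
    (hσ : ∀ y ∈ S, gradient G y - ∑ i, σ i y • gradient (F i) y ∈ TangentSpaceAt S y)
    (hx : x ∈ S) :
    HasFDerivWithinAt (riemGradient S f)
      (fderiv ℝ (gradient G) x - ∑ i, (σ i x • fderiv ℝ (gradient (F i)) x
        + (fderiv ℝ (σ i) x).smulRight (gradient (F i) x))) S x := by
  have hgr : Set.EqOn (riemGradient S f) (fun y => gradient G y - ∑ i, σ i y • gradient (F i) y)
      S := fun y hy => riemGradient_eq (hT y hy) (hG.differentiable two_ne_zero y) hfG hy (hσ y hy)
  refine HasFDerivWithinAt.congr (HasFDerivAt.hasFDerivWithinAt ?_) hgr (hgr hx)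
  exact (differentiableAt_gradient hG x).hasFDerivAt.sub (HasFDerivAt.fun_sum fun i _ =>
    (hσd i).hasFDerivAt.smul (differentiableAt_gradient (hF i) x).hasFDerivAt)

/-- The derivatives of the multipliers only contribute normal components. -/
theorem hessianForm_eq
    (hF : ∀ i, ContDiff ℝ 2 (F i))
    (hT : ∀ x ∈ S, ∀ v, v ∈ TangentSpaceAt S x ↔ ∀ i, fderiv ℝ (F i) x v = 0)
    (hG : ContDiff ℝ 2 G) (hfG : Set.EqOn f G S) (hσd : ∀ i, DifferentiableAt ℝ (σ i) x)
    (hσ : ∀ y ∈ S, gradient G y - ∑ i, σ i y • gradient (F i) y ∈ TangentSpaceAt S y)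
    (hx : x ∈ S) (η ξ : TangentSpaceAt S x) :
    hessianForm S f x η ξ
      = ambientHessian G x η ξ - ∑ i, σ i x * ambientHessian (F i) x η ξ := by
  have hd := hasFDerivWithinAt_riemGradient hF hT hG hfG hσd hσ hx
  have h0 : ∀ i, inner ℝ (gradient (F i) x) (ξ : E) = 0 := fun i => by
    rw [inner_gradient_left, (hT x hx ξ).1 ξ.2 i]
  rw [hessianForm, hessianOperator, inner_covDeriv _ _ ξ.2, hd.fderivWithin_apply_tangent η.2]
  simp [inner_sub_left, sum_inner, inner_add_left, inner_smul_left, h0, inner_fderiv_gradient, hG,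
    hF]

/-- Cramer's rule for a diagonal Gramian matrix. -/
theorem multiplier_eq_of_orthogonal {ι : Type*} [Fintype ι] [DecidableEq ι] (F : ι → E → ℝ)
    (G : E → ℝ) (x : E) {d : ι → ℝ} (hd : ∀ i, d i ≠ 0)
    (h : gramian F F x = Matrix.diagonal d) (i : ι) :
    multiplier F G i x = inner ℝ (gradient G x) (gradient (F i) x) / d i := by
  have hdet : (Matrix.diagonal d).det ≠ 0 := by
    rw [Matrix.det_diagonal]
    exact Finset.prod_ne_zero_iff.2 fun i _ => hd i
  set b : ι → ℝ := fun i => inner ℝ (gradient G x) (gradient (F i) x)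
  have hu : gramian F (Function.update F i G) x = (Matrix.diagonal d).updateCol i b := by
    rw [← h]
    ext j k
    by_cases hk : k = i
    · subst hk; simp [gramian, b]
    · simp [gramian, hk, Matrix.updateCol_ne]
  have hc := congrFun (Matrix.mulVec_cramer (Matrix.diagonal d) b) i
  rw [Matrix.mulVec_diagonal, Matrix.cramer_apply, Pi.smul_apply, smul_eq_mul] at hc
  rw [multiplier, hu, h, div_eq_div_iff hdet (hd i)]
  linarith

variable {d : ι → ℝ}

/-- Orthogonal gradients: subtracting the normal components of `grad G` leaves a tangent vector. -/
theorem gradient_sub_sum_mem_tangentSpaceAt [DecidableEq ι] (hd : ∀ i, d i ≠ 0)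
    (hT : ∀ v, v ∈ TangentSpaceAt S x ↔ ∀ i, fderiv ℝ (F i) x v = 0)
    (h : gramian F F x = Matrix.diagonal d) :
    gradient G x - ∑ i, (inner ℝ (gradient G x) (gradient (F i) x) / d i) • gradient (F i) x
      ∈ TangentSpaceAt S x := by
  refine (hT _).2 fun j => ?_
  have hij : ∀ i, inner ℝ (gradient (F j) x) (gradient (F i) x) = Matrix.diagonal d i j :=
    fun i => by rw [← h]; rfl
  rw [← inner_gradient_left, inner_sub_right, inner_sum, Finset.sum_eq_single j]
  · rw [inner_smul_right, hij, Matrix.diagonal_apply_eq, div_mul_cancel₀ _ (hd j),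
      real_inner_comm, sub_self]
  · intro i _ hi
    rw [inner_smul_right, hij, Matrix.diagonal_apply_ne _ hi, mul_zero]
  · simp

theorem differentiableAt_inner_gradient_div (hG : ContDiff ℝ 2 G) {H : E → ℝ}
    (hH : ContDiff ℝ 2 H) (c : ℝ) (x : E) :
    DifferentiableAt ℝ (fun y => inner ℝ (gradient G y) (gradient H y) / c) x := by
  simp only [div_eq_mul_inv]
  exact ((differentiableAt_gradient hG x).inner ℝ (differentiableAt_gradient hH x)).mul_const _

/-- The Hessian of the restriction of `G` to a level set with orthogonal gradients of constant
length. -/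
theorem hessianForm_eq_sub_sum_multiplier [DecidableEq ι] (hF : ∀ i, ContDiff ℝ 2 (F i))
    (hT : ∀ x ∈ S, ∀ v, v ∈ TangentSpaceAt S x ↔ ∀ i, fderiv ℝ (F i) x v = 0)
    (hG : ContDiff ℝ 2 G) (hfG : Set.EqOn f G S) (hd : ∀ i, d i ≠ 0)
    (h : ∀ y ∈ S, gramian F F y = Matrix.diagonal d) (hx : x ∈ S) (η ξ : TangentSpaceAt S x) :
    hessianForm S f x η ξ
      = ambientHessian G x η ξ - ∑ i, multiplier F G i x * ambientHessian (F i) x η ξ := by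
  simp only [multiplier_eq_of_orthogonal F G x hd (h x hx)]
  exact hessianForm_eq (σ := fun i y => inner ℝ (gradient G y) (gradient (F i) y) / d i) hF hT hG
    hfG (fun i => differentiableAt_inner_gradient_div hG (hF i) _ x)
    (fun y hy => gradient_sub_sum_mem_tangentSpaceAt hd (hT y hy) (h y hy)) hx η ξ

theorem differentiableWithinAt_riemGradient [DecidableEq ι] (hF : ∀ i, ContDiff ℝ 2 (F i))
    (hT : ∀ x ∈ S, ∀ v, v ∈ TangentSpaceAt S x ↔ ∀ i, fderiv ℝ (F i) x v = 0)
    (hG : ContDiff ℝ 2 G) (hfG : Set.EqOn f G S) (hd : ∀ i, d i ≠ 0)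
    (h : ∀ y ∈ S, gramian F F y = Matrix.diagonal d) (hx : x ∈ S) :
    DifferentiableWithinAt ℝ (riemGradient S f) S x :=
  (hasFDerivWithinAt_riemGradient
    (σ := fun i y => inner ℝ (gradient G y) (gradient (F i) y) / d i) hF hT hG
    hfG (fun i => differentiableAt_inner_gradient_div hG (hF i) _ x)
    (fun y hy => gradient_sub_sum_mem_tangentSpaceAt hd (hT y hy) (h y hy))
    hx).differentiableWithinAt

end Multipliers

end LevelSet

/-! ### Rows and gradients of the constraints -/

section Constraints

variable {n : ℕ}

/-- The `i`-th row as a continuous linear map on `ℝ^{n²}`. -/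
def rowL (i : Fin n) : EucMat n →L[ℝ] EuclideanSpace ℝ (Fin n) :=
  LinearMap.toContinuousLinearMap
    { toFun := fun x => rowVec x i
      map_add' := fun _ _ => rfl
      map_smul' := fun _ _ => rfl }

/-- The vector of `ℝ^{n²}` with `i`-th row `v` and all other rows zero. -/
def rowEmb (i : Fin n) : EuclideanSpace ℝ (Fin n) →L[ℝ] EucMat n :=
  LinearMap.toContinuousLinearMap
    { toFun := fun v => WithLp.toLp 2 fun ab => if ab.1 = i then v ab.2 else 0
      map_add' := fun u v => by ext ab; by_cases h : ab.1 = i <;> simp [h]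
      map_smul' := fun c v => by ext ab; by_cases h : ab.1 = i <;> simp [h] }

theorem rowL_apply (i : Fin n) (x : EucMat n) : rowL i x = rowVec x i := rfl

theorem inner_rowVec (x y : EucMat n) (i j : Fin n) :
    inner ℝ (rowVec x i) (rowVec y j) = ∑ k, x (i, k) * y (j, k) := by
  simp [PiLp.inner_apply, rowVec, mul_comm]

theorem rowVec_rowEmb (i j : Fin n) (v : EuclideanSpace ℝ (Fin n)) :
    rowVec (rowEmb i v) j = if j = i then v else 0 := by
  ext k
  by_cases h : j = i <;> simp [rowVec, rowEmb, h]

theorem inner_rowEmb (i : Fin n) (v : EuclideanSpace ℝ (Fin n)) (x : EucMat n) :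
    inner ℝ (rowEmb i v) x = inner ℝ v (rowVec x i) := by
  simp [PiLp.inner_apply, rowVec, rowEmb, Fintype.sum_prod_type]

theorem rowVec_gradient (G : EucMat n → ℝ) (x : EucMat n) (i : Fin n) :
    rowVec (gradient G x) i = partialRow G i x := by
  ext j
  refine Eq.trans ?_ inner_gradient_left
  rw [eVec, EuclideanSpace.inner_single_right]
  simp [rowVec]

theorem hasFDerivAt_innerConstraint (p q : Fin n) (x : EucMat n) :
    HasFDerivAt (innerConstraint p q)
      ((fderivInnerCLM ℝ (rowL p x, rowL q x)).comp ((rowL p).prod (rowL q))) x :=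
  (rowL p).hasFDerivAt.inner ℝ (rowL q).hasFDerivAt

theorem gradient_innerConstraint (p q : Fin n) (x : EucMat n) :
    gradient (innerConstraint p q) x = rowEmb p (rowVec x q) + rowEmb q (rowVec x p) := by
  refine ext_inner_right ℝ fun v => ?_
  rw [inner_gradient_left, (hasFDerivAt_innerConstraint p q x).fderiv, inner_add_left, inner_rowEmb,
    inner_rowEmb]
  simp [fderivInnerCLM_apply, rowL_apply, real_inner_comm, add_comm]

/-- `F_s = ½ F_{ss}` reduces the norm constraints to the bilinear ones. -/
theorem normConstraint_eq (s : Fin n) :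
    normConstraint s = fun x : EucMat n => (1 / 2 : ℝ) * innerConstraint s s x := by
  ext x
  rw [normConstraint, innerConstraint, real_inner_self_eq_norm_sq]

theorem gradient_normConstraint (s : Fin n) (x : EucMat n) :
    gradient (normConstraint s) x = rowEmb s (rowVec x s) := by
  refine ext_inner_right ℝ fun v => ?_
  rw [inner_gradient_left, normConstraint_eq,
    ((hasFDerivAt_innerConstraint s s x).const_mul (1 / 2)).fderiv]
  rw [smul_apply, ← (hasFDerivAt_innerConstraint s s x).fderiv, ← inner_gradient_left,
    gradient_innerConstraint, inner_add_left, inner_rowEmb, smul_eq_mul]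
  ring

theorem contDiff_innerConstraint (p q : Fin n) : ContDiff ℝ 2 (innerConstraint (n := n) p q) :=
  (rowL p).contDiff.inner ℝ (rowL q).contDiff

theorem contDiff_normConstraint (s : Fin n) : ContDiff ℝ 2 (normConstraint (n := n) s) := by
  rw [normConstraint_eq]
  exact contDiff_const.mul (contDiff_innerConstraint s s)

theorem contDiff_constraints (i : Fin n ⊕ UpperPair n) : ContDiff ℝ 2 (constraints n i) := by
  rcases i with s | pq
  · exact contDiff_normConstraint s
  · exact contDiff_innerConstraint _ _

theorem ambientHessian_normConstraint (s : Fin n) (x η ξ : EucMat n) :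
    ambientHessian (normConstraint s) x η ξ = inner ℝ (rowVec η s) (rowVec ξ s) := by
  have h : gradient (normConstraint s) = (rowEmb s ∘L rowL s : EucMat n →L[ℝ] EucMat n) :=
    funext fun y => gradient_normConstraint s y
  rw [← inner_fderiv_gradient (contDiff_normConstraint s), h, ContinuousLinearMap.fderiv]
  exact inner_rowEmb _ _ _

theorem ambientHessian_innerConstraint (p q : Fin n) (x η ξ : EucMat n) :
    ambientHessian (innerConstraint p q) x η ξ
      = inner ℝ (rowVec η q) (rowVec ξ p) + inner ℝ (rowVec η p) (rowVec ξ q) := by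
  have h : gradient (innerConstraint p q)
      = (rowEmb p ∘L rowL q + rowEmb q ∘L rowL p : EucMat n →L[ℝ] EucMat n) :=
    funext fun y => gradient_innerConstraint p q y
  rw [← inner_fderiv_gradient (contDiff_innerConstraint p q), h, ContinuousLinearMap.fderiv,
    ← inner_rowEmb, ← inner_rowEmb, ← inner_add_left]
  rfl

theorem inner_gradient_normConstraint (G : EucMat n → ℝ) (x : EucMat n) (s : Fin n) :
    inner ℝ (gradient G x) (gradient (normConstraint s) x)
      = inner ℝ (partialRow G s x) (rowVec x s) := by
  rw [gradient_normConstraint, real_inner_comm, inner_rowEmb, rowVec_gradient, real_inner_comm]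

theorem inner_gradient_innerConstraint (G : EucMat n → ℝ) (x : EucMat n) (p q : Fin n) :
    inner ℝ (gradient G x) (gradient (innerConstraint p q) x)
      = inner ℝ (partialRow G p x) (rowVec x q) + inner ℝ (partialRow G q x) (rowVec x p) := by
  rw [gradient_innerConstraint, real_inner_comm, inner_add_left, inner_rowEmb, inner_rowEmb,
    rowVec_gradient, rowVec_gradient, real_inner_comm, real_inner_comm (partialRow G q x)]

end Constraints

/-! ### The orthogonal group as a level set -/

section OrthSet

variable {n : ℕ} {x : EucMat n}

theorem mem_orthSet_iff_matrix :
    x ∈ orthSet n ↔ (matVec n).symm x * ((matVec n).symm x).transpose = 1 := by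
  constructor
  · rintro ⟨X, hX, rfl⟩
    simpa [Matrix.star_eq_conjTranspose] using (Matrix.mem_orthogonalGroup_iff _ _).1 hX
  · intro h
    refine ⟨(matVec n).symm x, (Matrix.mem_orthogonalGroup_iff _ _).2 ?_, by simp⟩
    simpa [Matrix.star_eq_conjTranspose] using h

theorem mem_orthSet_iff :
    x ∈ orthSet n ↔ ∀ i j, inner ℝ (rowVec x i) (rowVec x j) = if i = j then 1 else 0 := by
  rw [mem_orthSet_iff_matrix, ← Matrix.ext_iff]
  refine forall_congr' fun i => forall_congr' fun j => ?_
  rw [inner_rowVec, Matrix.one_apply]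
  rfl

theorem orthSet_eq_levelSet :
    orthSet n
      = {x | (∀ s, normConstraint s x = 1 / 2) ∧ ∀ p q, p < q → innerConstraint p q x = 0} := by
  ext x
  rw [mem_orthSet_iff, Set.mem_ofPred_eq]
  simp only [normConstraint_eq, innerConstraint]
  constructor
  · intro h
    exact ⟨fun s => by rw [h, if_pos rfl, mul_one], fun p q hpq => by simp [h, hpq.ne]⟩
  · rintro ⟨h1, h2⟩ i j
    rcases lt_trichotomy i j with h | rfl | h
    · rw [h2 i j h, if_neg h.ne]
    · rw [if_pos rfl]; linarith [h1 i]
    · rw [real_inner_comm, h2 j i h, if_neg h.ne']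

/-- The squared norms of the gradients of the constraints along `𝒪(n)`. -/
def gradNormSq (n : ℕ) : Fin n ⊕ UpperPair n → ℝ := Sum.elim (fun _ => 1) fun _ => 2

theorem gradNormSq_ne_zero (i : Fin n ⊕ UpperPair n) : gradNormSq n i ≠ 0 := by
  rcases i with s | pq <;> simp [gradNormSq]

/-- The gradients are orthogonal along `𝒪(n)` because the rows are orthonormal there. -/
theorem gramian_constraints (hx : x ∈ orthSet n) :
    gramian (constraints n) (constraints n) x = Matrix.diagonal (gradNormSq n) := by
  rw [mem_orthSet_iff] at hx
  ext i j
  rw [gramian, Matrix.of_apply]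
  rcases i with s | ⟨⟨p, q⟩, hpq⟩ <;> rcases j with t | ⟨⟨p', q'⟩, hpq'⟩ <;>
    simp only [constraints, Sum.elim_inl, Sum.elim_inr, gradient_normConstraint,
      gradient_innerConstraint, inner_rowEmb, rowVec_rowEmb, inner_add_left, inner_add_right,
      apply_ite (inner ℝ _), inner_zero_right, hx, Matrix.diagonal_apply, gradNormSq,
      Sum.inl.injEq, Sum.inr.injEq, reduceCtorEq, Subtype.mk.injEq, Prod.mk.injEq] <;>
    grind

theorem linearIndependent_gradient_constraints (hx : x ∈ orthSet n) :
    LinearIndependent ℝ fun i => gradient (constraints n i) x := by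
  have h : ∀ i j, inner ℝ (gradient (constraints n j) x) (gradient (constraints n i) x)
      = Matrix.diagonal (gradNormSq n) i j := fun i j => by
    rw [← gramian_constraints hx]; rfl
  refine linearIndependent_of_ne_zero_of_inner_eq_zero (fun i h0 => ?_) fun i j hij => ?_
  · have := h i i
    rw [h0, Matrix.diagonal_apply_eq, inner_zero_left] at this
    exact gradNormSq_ne_zero i this.symm
  · exact (h j i).trans (Matrix.diagonal_apply_ne _ hij.symm)

open scoped Matrix.Norms.Operator in
/-- The curve `t ↦ exp(tK) X` through `X` stays in `𝒪(n)` if `K` is skew-symmetric. -/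
theorem matVec_skew_mul_mem_tangentConeAt (hx : x ∈ orthSet n) {K : Matrix (Fin n) (Fin n) ℝ}
    (hK : K.transpose = -K) :
    matVec n (K * (matVec n).symm x) ∈ tangentConeAt ℝ (orthSet n) x := by
  set X := (matVec n).symm x with hX
  have hxX : x = matVec n X := by simp [hX]
  let c : ℝ → EucMat n := fun t => matVec n (NormedSpace.exp (t • K) * X)
  have hc : HasDerivAt c (matVec n (K * X)) 0 := by
    have h1 := (hasDerivAt_exp_smul_const (𝕂 := ℝ) K (0 : ℝ)).mul_const X
    have h2 := (LinearMap.toContinuousLinearMap (matVec n).toLinearMap).hasFDerivAt.comp_hasDerivAt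
      (0 : ℝ) h1
    rw [zero_smul, NormedSpace.exp_zero, Matrix.one_mul] at h2
    exact h2
  have hmem : ∀ t, c t ∈ orthSet n := fun t => by
    rw [mem_orthSet_iff_matrix] at hx ⊢
    simp only [c, LinearEquiv.symm_apply_apply]
    rw [Matrix.transpose_mul, Matrix.mul_assoc, ← Matrix.mul_assoc X, hx, Matrix.one_mul,
      ← Matrix.exp_transpose, Matrix.transpose_smul, hK, smul_neg, Matrix.exp_neg]
    exact Matrix.mul_nonsing_inv _ ((Matrix.isUnit_iff_isUnit_det _).1 (Matrix.isUnit_exp _))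
  have h0 : c 0 = x := by simp [c, hxX]
  have := hc.hasFDerivAt.hasFDerivWithinAt (s := Set.univ) |>.mapsTo_tangent_cone
    (show (1 : ℝ) ∈ tangentConeAt ℝ Set.univ 0 by rw [tangentConeAt_univ]; trivial)
  rw [h0] at this
  refine tangentConeAt_mono ?_ (by simpa using this)
  rintro _ ⟨t, -, rfl⟩
  exact hmem t

/-- `dF_s(v) = ⟨x_s, v_s⟩` and `dF_{pq}(v) = ⟨x_p, v_q⟩ + ⟨x_q, v_p⟩` are the entries of the
symmetric part of `V Xᵀ` up to a factor. -/
theorem mul_transpose_skew_of_fderiv_constraints {v : EucMat n}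
    (h : ∀ i, fderiv ℝ (constraints n i) x v = 0) :
    ((matVec n).symm v * ((matVec n).symm x).transpose).transpose
      = -((matVec n).symm v * ((matVec n).symm x).transpose) := by
  set X := (matVec n).symm x
  set V := (matVec n).symm v
  have hs : ∀ p q, inner ℝ (rowVec x p) (rowVec v q) = -inner ℝ (rowVec x q) (rowVec v p) := by
    have hlt : ∀ p q, p < q →
        inner ℝ (rowVec x p) (rowVec v q) = -inner ℝ (rowVec x q) (rowVec v p) := by
      intro p q hpq
      have := h (Sum.inr ⟨(p, q), hpq⟩)
      rw [← inner_gradient_left] at this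
      simp only [constraints, Sum.elim_inr, gradient_innerConstraint, inner_add_left,
        inner_rowEmb] at this
      linarith
    intro p q
    rcases lt_trichotomy p q with h' | rfl | h'
    · exact hlt p q h'
    · have := h (Sum.inl p)
      rw [← inner_gradient_left] at this
      simp only [constraints, Sum.elim_inl, gradient_normConstraint, inner_rowEmb] at this
      rw [this, neg_zero]
    · rw [hlt q p h', neg_neg]
  ext p q
  have := hs p q
  rw [inner_rowVec, inner_rowVec] at this
  rw [Matrix.transpose_mul, Matrix.transpose_transpose, Matrix.neg_apply, Matrix.mul_apply,
    Matrix.mul_apply]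
  exact this.trans (congrArg Neg.neg (Finset.sum_congr rfl fun j _ => mul_comm _ _))

/-- The tangent space of `𝒪(n)` is the common kernel of the differentials of the constraints. -/
theorem mem_tangentSpaceAt_orthSet (hx : x ∈ orthSet n) (v : EucMat n) :
    v ∈ TangentSpaceAt (orthSet n) x ↔ ∀ i, fderiv ℝ (constraints n i) x v = 0 := by
  constructor
  · intro hv i
    have hd : HasFDerivWithinAt (constraints n i) (fderiv ℝ (constraints n i) x) (orthSet n) x :=
      ((contDiff_constraints i).differentiable two_ne_zero x).hasFDerivAt.hasFDerivWithinAt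
    have h0 : HasFDerivWithinAt (constraints n i) (0 : EucMat n →L[ℝ] ℝ) (orthSet n) x := by
      -- each constraint is constant on the level set
      have hcst : ∀ y ∈ orthSet n, constraints n i y = Sum.elim (fun _ => 1 / 2) (fun _ => 0) i := by
        intro y hy
        rw [orthSet_eq_levelSet] at hy
        rcases i with s | pq
        · exact hy.1 s
        · exact hy.2 _ _ pq.2
      exact (hasFDerivWithinAt_const _ x _).congr hcst (hcst x hx)
    exact (hd.fderivWithin_apply_tangent hv).symm.trans (h0.fderivWithin_apply_tangent hv)
  · intro h
    have hmem := matVec_skew_mul_mem_tangentConeAt hx (mul_transpose_skew_of_fderiv_constraints h)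
    rw [Matrix.mul_assoc, mul_eq_one_comm.1 (mem_orthSet_iff_matrix.1 hx), Matrix.mul_one,
      LinearEquiv.apply_symm_apply] at hmem
    exact Submodule.subset_span hmem

end OrthSet

/-! ### The basis of the tangent space -/

section TangentBasis

variable {n : ℕ} {x : EucMat n}

theorem skewBasis_transpose (α β : Fin n) : (skewBasis α β).transpose = -skewBasis α β := by
  simp [skewBasis, ← smul_neg]

theorem skewBasis_apply (α β i j : Fin n) :
    skewBasis α β i j
      = (-1 : ℝ) ^ ((α : ℕ) + (β : ℕ)) * (kron α i * kron β j - kron β i * kron α j) := by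
  simp only [skewBasis, kron, Matrix.smul_apply, Matrix.sub_apply, Matrix.single_apply, smul_eq_mul]
  grind

theorem skewBasis_apply_of_lt (pq rt : UpperPair n) :
    skewBasis pq.1.1 pq.1.2 rt.1.1 rt.1.2
      = if pq = rt then (-1 : ℝ) ^ ((pq.1.1 : ℕ) + (pq.1.2 : ℕ)) else 0 := by
  obtain ⟨⟨p, q⟩, hpq⟩ := pq
  obtain ⟨⟨r, t⟩, hrt⟩ := rt
  simp only [skewBasis_apply, kron, Subtype.mk.injEq, Prod.mk.injEq]
  grind

theorem linearIndependent_skewBasis :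
    LinearIndependent ℝ fun pq : UpperPair n => skewBasis pq.1.1 pq.1.2 := by
  refine Fintype.linearIndependent_iff.2 fun c hc rt => ?_
  have h := congrFun (congrFun hc rt.1.1) rt.1.2
  simpa [Matrix.sum_apply, skewBasis_apply_of_lt] using h

theorem neg_one_pow_mul_self (k : ℕ) : (-1 : ℝ) ^ k * (-1 : ℝ) ^ k = 1 := by
  rw [← mul_pow]; norm_num

theorem eq_sum_skewBasis {A : Matrix (Fin n) (Fin n) ℝ} (hA : A.transpose = -A) :
    A = ∑ pq : UpperPair n,
      ((-1 : ℝ) ^ ((pq.1.1 : ℕ) + (pq.1.2 : ℕ)) * A pq.1.1 pq.1.2) • skewBasis pq.1.1 pq.1.2 := by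
  set B := ∑ pq : UpperPair n,
    ((-1 : ℝ) ^ ((pq.1.1 : ℕ) + (pq.1.2 : ℕ)) * A pq.1.1 pq.1.2) • skewBasis pq.1.1 pq.1.2 with hB
  have hBt : B.transpose = -B := by
    simp [hB, Matrix.transpose_sum, skewBasis_transpose]
  -- both sides are skew-symmetric, hence determined by their entries above the diagonal
  have hlt : ∀ i j, i < j → A i j = B i j := by
    intro i j hij
    have h := fun pq : UpperPair n => skewBasis_apply_of_lt pq ⟨(i, j), hij⟩
    simp only at h
    simp only [hB, Matrix.sum_apply, Matrix.smul_apply, h, smul_eq_mul, mul_ite, mul_zero,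
      Finset.sum_ite_eq', Finset.mem_univ, if_true]
    rw [mul_right_comm, neg_one_pow_mul_self, one_mul]
  have hA' : ∀ i j, A j i = -A i j := fun i j => congrFun (congrFun hA i) j
  have hB' : ∀ i j, B j i = -B i j := fun i j => congrFun (congrFun hBt i) j
  ext i j
  rcases lt_trichotomy i j with h | rfl | h
  · exact hlt i j h
  · linarith [hA' i i, hB' i i]
  · rw [hA' j i, hB' j i, hlt j i h]

/-- The linear map `A ↦ ℐ(X A)`, where `x = ℐ(X)`. -/
def leftMul (x : EucMat n) : Matrix (Fin n) (Fin n) ℝ →ₗ[ℝ] EucMat n :=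
  (matVec n).toLinearMap ∘ₗ LinearMap.mulLeft ℝ ((matVec n).symm x)

theorem leftMul_apply (A : Matrix (Fin n) (Fin n) ℝ) :
    leftMul x A = matVec n ((matVec n).symm x * A) := rfl

theorem leftMul_injective (hx : x ∈ orthSet n) : Function.Injective (leftMul x) := by
  have hX := mul_eq_one_comm.1 (mem_orthSet_iff_matrix.1 hx)
  intro A B hAB
  have h := congrArg (fun M => ((matVec n).symm x).transpose * M) ((matVec n).injective hAB)
  simpa [← Matrix.mul_assoc, hX] using h

/-- `X A = (X A Xᵀ) X` is the velocity of a curve in `𝒪(n)`. -/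
theorem leftMul_skew_mem (hx : x ∈ orthSet n) {A : Matrix (Fin n) (Fin n) ℝ}
    (hA : A.transpose = -A) : leftMul x A ∈ TangentSpaceAt (orthSet n) x := by
  have h := matVec_skew_mul_mem_tangentConeAt hx
    (K := (matVec n).symm x * A * ((matVec n).symm x).transpose)
    (by simp [hA, Matrix.mul_assoc])
  rw [Matrix.mul_assoc _ _ ((matVec n).symm x),
    mul_eq_one_comm.1 (mem_orthSet_iff_matrix.1 hx), Matrix.mul_one] at h
  exact Submodule.subset_span h

/-- The matrix is `A = Xᵀ V` for the tangent vector `ℐ(V)`. -/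
theorem exists_skew_of_mem_tangentSpaceAt (hx : x ∈ orthSet n) {v : EucMat n}
    (hv : v ∈ TangentSpaceAt (orthSet n) x) :
    ∃ A : Matrix (Fin n) (Fin n) ℝ, A.transpose = -A ∧ leftMul x A = v := by
  have hK := mul_transpose_skew_of_fderiv_constraints ((mem_tangentSpaceAt_orthSet hx v).1 hv)
  have hX := mem_orthSet_iff_matrix.1 hx
  set X := (matVec n).symm x
  set V := (matVec n).symm v with hV
  refine ⟨X.transpose * V, ?_, ?_⟩
  · have : X.transpose * V = X.transpose * (V * X.transpose) * X := by
      rw [Matrix.mul_assoc, Matrix.mul_assoc, mul_eq_one_comm.1 hX, Matrix.mul_one]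
    rw [this, Matrix.transpose_mul, Matrix.transpose_mul, hK]
    simp [Matrix.mul_assoc]
  · rw [leftMul_apply, ← Matrix.mul_assoc, hX, Matrix.one_mul, hV, LinearEquiv.apply_symm_apply]

theorem tangentVec_mem (hx : x ∈ orthSet n) (α β : Fin n) :
    tangentVec x α β ∈ TangentSpaceAt (orthSet n) x :=
  leftMul_skew_mem hx (skewBasis_transpose α β)

/-- The basis of the tangent space at `X` by the vectors `X Ω_{αβ}`, `α < β`. -/
def tangentBasis (hx : x ∈ orthSet n) :
    Module.Basis (UpperPair n) ℝ (TangentSpaceAt (orthSet n) x) :=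
  Module.Basis.mk
    (v := fun pq => ⟨tangentVec x pq.1.1 pq.1.2, tangentVec_mem hx pq.1.1 pq.1.2⟩)
    (LinearIndependent.of_comp (TangentSpaceAt (orthSet n) x).subtype
      (linearIndependent_skewBasis.map' (leftMul x)
        (LinearMap.ker_eq_bot.2 (leftMul_injective hx))))
    (by
      rintro ⟨v, hv⟩ -
      obtain ⟨A, hA, rfl⟩ := exists_skew_of_mem_tangentSpaceAt hx hv
      rw [Submodule.mem_span_range_iff_exists_fun]
      refine ⟨fun pq => (-1 : ℝ) ^ ((pq.1.1 : ℕ) + (pq.1.2 : ℕ)) * A pq.1.1 pq.1.2, ?_⟩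
      ext1
      refine Eq.trans ?_ (congrArg (leftMul x) (eq_sum_skewBasis hA)).symm
      simp only [map_sum, map_smul, Submodule.coe_sum, Submodule.coe_smul]
      rfl)

theorem coe_tangentBasis (hx : x ∈ orthSet n) (pq : UpperPair n) :
    (tangentBasis hx pq : EucMat n) = tangentVec x pq.1.1 pq.1.2 := by
  simp [tangentBasis]

theorem tangentVec_apply (x : EucMat n) (α β i j : Fin n) :
    tangentVec x α β (i, j)
      = (-1 : ℝ) ^ ((α : ℕ) + (β : ℕ)) * (x (i, α) * kron β j - x (i, β) * kron α j) := by
  have : tangentVec x α β (i, j) = ∑ k, x (i, k) * skewBasis α β k j := rfl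
  rw [this]
  simp [skewBasis_apply, kron, mul_sub, Finset.sum_sub_distrib]
  split_ifs <;> ring

theorem eVec_apply (i j k l : Fin n) : eVec i j (k, l) = kron i k * kron j l := by
  simp only [eVec, PiLp.single_apply, kron, Prod.mk.injEq]
  grind

theorem tangentVec_eq_sum (x : EucMat n) (α β : Fin n) :
    tangentVec x α β
      = (-1 : ℝ) ^ ((α : ℕ) + (β : ℕ)) • ∑ i, (x (i, α) • eVec i β - x (i, β) • eVec i α) := by
  ext ⟨i, j⟩
  rw [tangentVec_apply]
  simp [eVec_apply, kron, Finset.sum_sub_distrib]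

theorem inner_rowVec_tangentVec (x : EucMat n) (γ τ α β p q : Fin n) :
    inner ℝ (rowVec (tangentVec x γ τ) p) (rowVec (tangentVec x α β) q)
      = (-1 : ℝ) ^ ((α : ℕ) + (β : ℕ) + (γ : ℕ) + (τ : ℕ)) *
        (x (p, τ) * x (q, β) * kron γ α - x (p, γ) * x (q, β) * kron τ α
          - x (p, τ) * x (q, α) * kron γ β + x (p, γ) * x (q, α) * kron τ β) := by
  have hk : ∀ i j : Fin n, ∑ k, kron i k * kron j k = (kron i j : ℝ) := fun i j => by
    simp [kron]
  rw [inner_rowVec]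
  simp only [tangentVec_apply]
  rw [← hk γ α, ← hk τ α, ← hk γ β, ← hk τ β]
  simp only [Finset.mul_sum, ← Finset.sum_sub_distrib, ← Finset.sum_add_distrib]
  refine Finset.sum_congr rfl fun k _ => ?_
  ring

end TangentBasis

/-! ### The Hessian in coordinates -/

section Coordinates

variable {n : ℕ} {G : EucMat n → ℝ}

theorem partialD2_eq (hG : ContDiff ℝ 2 G) (a b c d : Fin n) (x : EucMat n) :
    partialD2 G a b c d x = fderiv ℝ (fderiv ℝ G) x (eVec a b) (eVec c d) := by
  have h := (hasFDerivAt_fderiv hG x).clm_apply (hasFDerivAt_const (eVec c d : EucMat n) x)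
  unfold partialD2 partialD
  rw [h.fderiv]
  simp

theorem eq_sum_eVec (η : EucMat n) : η = ∑ ab : Fin n × Fin n, η ab • eVec ab.1 ab.2 := by
  ext ⟨i, j⟩
  simp [eVec_apply, kron, Fintype.sum_prod_type]

theorem ambientHessian_eq_sum (hG : ContDiff ℝ 2 G) (x η ξ : EucMat n) :
    ambientHessian G x η ξ
      = ∑ a, ∑ b, ∑ c, ∑ d, partialD2 G a b c d x * (η (a, b) * ξ (c, d)) := by
  have h : ambientHessian G x η ξ = ∑ ab : Fin n × Fin n, ∑ cd : Fin n × Fin n,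
      partialD2 G ab.1 ab.2 cd.1 cd.2 x * (η ab * ξ cd) := by
    unfold ambientHessian
    conv_lhs => rw [eq_sum_eVec η, eq_sum_eVec ξ]
    simp only [map_sum, map_smul, sum_apply, smul_apply, smul_eq_mul, partialD2_eq hG,
      Finset.mul_sum]
    -- expanding the second argument first puts the sum over `cd` outside
    rw [Finset.sum_comm]
    exact Finset.sum_congr rfl fun ab _ => Finset.sum_congr rfl fun cd _ => by ring
  simpa only [Fintype.sum_prod_type] using h

theorem ambientHessian_tangentVec (hG : ContDiff ℝ 2 G) (x : EucMat n) (γ τ α β : Fin n) :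
    ambientHessian G x (tangentVec x γ τ) (tangentVec x α β)
      = (-1 : ℝ) ^ ((α : ℕ) + (β : ℕ) + (γ : ℕ) + (τ : ℕ)) *
        ∑ a, ∑ c,
          (x (a, γ) * x (c, α) * partialD2 G a τ c β x
            - x (a, γ) * x (c, β) * partialD2 G a τ c α x
            - x (a, τ) * x (c, α) * partialD2 G a γ c β x
            + x (a, τ) * x (c, β) * partialD2 G a γ c α x) := by
  unfold ambientHessian
  rw [tangentVec_eq_sum, tangentVec_eq_sum]
  simp only [map_sum, map_smul, map_sub, sum_apply, smul_apply, smul_eq_mul, partialD2_eq hG,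
    sub_apply, ← Finset.sum_sub_distrib, Finset.mul_sum]
  rw [Finset.sum_comm]
  refine Finset.sum_congr rfl fun a _ => Finset.sum_congr rfl fun c _ => ?_
  ring

theorem inner_partialRow_rowVec (G : EucMat n → ℝ) (x : EucMat n) (p q : Fin n) :
    inner ℝ (partialRow G p x) (rowVec x q) = ∑ i, x (q, i) * partialD G p i x := by
  simp [PiLp.inner_apply, partialRow, rowVec]

end Coordinates

/-! ### The Hessian on the orthogonal group -/

theorem eqOn_onOrthSet {n : ℕ} {g : Matrix.orthogonalGroup (Fin n) ℝ → ℝ} {G : EucMat n → ℝ}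
    (hgG : ∀ X : Matrix.orthogonalGroup (Fin n) ℝ,
      G (matVec n (X : Matrix (Fin n) (Fin n) ℝ)) = g X) :
    Set.EqOn (onOrthSet g) G (orthSet n) := by
  rintro _ ⟨X, hX, rfl⟩
  have hinj : Function.Injective fun X : Matrix.orthogonalGroup (Fin n) ℝ =>
      matVec n (X : Matrix (Fin n) (Fin n) ℝ) :=
    (matVec n).injective.comp Subtype.val_injective
  exact (hinj.extend_apply g 0 ⟨X, hX⟩).trans (hgG ⟨X, hX⟩).symm

theorem multiplier_normConstraint {n : ℕ} (G : EucMat n → ℝ) {x : EucMat n} (hx : x ∈ orthSet n)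
    (s : Fin n) :
    multiplier (constraints n) G (Sum.inl s) x = inner ℝ (partialRow G s x) (rowVec x s) := by
  rw [multiplier_eq_of_orthogonal _ G x gradNormSq_ne_zero (gramian_constraints hx)]
  exact (div_one _).trans (inner_gradient_normConstraint G x s)

theorem multiplier_innerConstraint {n : ℕ} (G : EucMat n → ℝ) {x : EucMat n} (hx : x ∈ orthSet n)
    (pq : UpperPair n) :
    multiplier (constraints n) G (Sum.inr pq) x
      = 1 / 2 * (inner ℝ (partialRow G pq.1.1 x) (rowVec x pq.1.2)
          + inner ℝ (partialRow G pq.1.2 x) (rowVec x pq.1.1)) := by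
  rw [multiplier_eq_of_orthogonal _ G x gradNormSq_ne_zero (gramian_constraints hx),
    ← inner_gradient_innerConstraint, div_eq_inv_mul, one_div]
  rfl

theorem hessianForm_orthSet {n : ℕ} {f G : EucMat n → ℝ} (hG : ContDiff ℝ 2 G)
    (hfG : Set.EqOn f G (orthSet n)) {x : EucMat n} (hx : x ∈ orthSet n)
    (η ξ : TangentSpaceAt (orthSet n) x) :
    hessianForm (orthSet n) f x η ξ
      = ambientHessian G x η ξ
        - ∑ s : Fin n, inner ℝ (partialRow G s x) (rowVec x s)
            * ambientHessian (normConstraint s) x η ξ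
        - 1 / 2 * ∑ pq : UpperPair n,
            (inner ℝ (partialRow G pq.1.1 x) (rowVec x pq.1.2)
              + inner ℝ (partialRow G pq.1.2 x) (rowVec x pq.1.1))
            * ambientHessian (innerConstraint pq.1.1 pq.1.2) x η ξ := by
  rw [hessianForm_eq_sub_sum_multiplier contDiff_constraints
    (fun y hy => mem_tangentSpaceAt_orthSet hy) hG hfG gradNormSq_ne_zero
    (fun y hy => gramian_constraints hy) hx, Fintype.sum_sum_type, ← sub_sub, Finset.mul_sum]
  simp only [multiplier_normConstraint G hx, multiplier_innerConstraint G hx, mul_assoc]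
  rfl

end

theorem mainTheorem2 (n : ℕ) (g : Matrix.orthogonalGroup (Fin n) ℝ → ℝ) (G : EucMat n → ℝ)
    (hG : ContDiff ℝ 2 G)
    (hgG : ∀ X : Matrix.orthogonalGroup (Fin n) ℝ,
      G (matVec n (X : Matrix (Fin n) (Fin n) ℝ)) = g X) :
    -- `𝒪(n)` is the level set of a regular value of the constraint functions
    orthSet n = {x | (∀ s, normConstraint s x = 1 / 2) ∧ ∀ p q, p < q → innerConstraint p q x = 0} ∧
    (∀ x ∈ orthSet n, LinearIndependent ℝ fun i => gradient (constraints n i) x) ∧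
    -- `covDeriv` is the Levi-Civita connection of the induced metric
    IsLeviCivita (orthSet n) (covDeriv (orthSet n)) ∧
    ∀ x ∈ orthSet n,
      -- the cost function and its Riemannian gradient are differentiable along `𝒪(n)`
      DifferentiableWithinAt ℝ (onOrthSet g) (orthSet n) x ∧
      DifferentiableWithinAt ℝ (riemGradient (orthSet n) (onOrthSet g)) (orthSet n) x ∧
      -- the multipliers
      (gramian (constraints n) (constraints n) x).det ≠ 0 ∧
      (∀ s : Fin n, multiplier (constraints n) G (Sum.inl s) x
        = inner ℝ (partialRow G s x) (rowVec x s)) ∧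
      (∀ pq : UpperPair n, multiplier (constraints n) G (Sum.inr pq) x
        = 1 / 2 * (inner ℝ (partialRow G pq.1.1 x) (rowVec x pq.1.2)
            + inner ℝ (partialRow G pq.1.2 x) (rowVec x pq.1.1))) ∧
      -- the Hessian tensor on the tangent space
      (∀ η ξ : TangentSpaceAt (orthSet n) x,
        hessianForm (orthSet n) (onOrthSet g) x η ξ
          = ambientHessian G x η ξ
            - ∑ s : Fin n, inner ℝ (partialRow G s x) (rowVec x s)
                * ambientHessian (normConstraint s) x η ξ
            - 1 / 2 * ∑ pq : UpperPair n,
                (inner ℝ (partialRow G pq.1.1 x) (rowVec x pq.1.2)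
                  + inner ℝ (partialRow G pq.1.2 x) (rowVec x pq.1.1))
                * ambientHessian (innerConstraint pq.1.1 pq.1.2) x η ξ) ∧
      -- the same in Euclidean coordinates
      (∀ η ξ : TangentSpaceAt (orthSet n) x,
        hessianForm (orthSet n) (onOrthSet g) x η ξ
          = ∑ a, ∑ b, ∑ c, ∑ d,
                partialD2 G a b c d x * ((η : EucMat n) (a, b) * (ξ : EucMat n) (c, d))
            - ∑ i, ∑ j, ∑ s, x (s, i) * partialD G s i x
                * ((η : EucMat n) (s, j) * (ξ : EucMat n) (s, j))
            - 1 / 2 * ∑ pq : UpperPair n, ∑ i, ∑ j,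
                (x (pq.1.2, i) * partialD G pq.1.1 i x + x (pq.1.1, i) * partialD G pq.1.2 i x)
                * ((η : EucMat n) (pq.1.1, j) * (ξ : EucMat n) (pq.1.2, j)
                  + (η : EucMat n) (pq.1.2, j) * (ξ : EucMat n) (pq.1.1, j))) ∧
      -- the Euclidean coordinates of the tangent vectors `X Ω_{αβ}`
      (∀ α β : Fin n, α < β → tangentVec x α β
        = (-1 : ℝ) ^ ((α : ℕ) + (β : ℕ)) • ∑ i, (x (i, α) • eVec i β - x (i, β) • eVec i α)) ∧
      -- these vectors form a basis of the tangent space, and the Hessian matrix in that basis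
      ∃ B : Module.Basis (UpperPair n) ℝ (TangentSpaceAt (orthSet n) x),
        (∀ αβ : UpperPair n, (B αβ : EucMat n) = tangentVec x αβ.1.1 αβ.1.2) ∧
        ∀ (γ τ α β : Fin n) (hγτ : γ < τ) (hαβ : α < β),
          hessianForm (orthSet n) (onOrthSet g) x (B ⟨(γ, τ), hγτ⟩) (B ⟨(α, β), hαβ⟩)
            = (-1 : ℝ) ^ ((α : ℕ) + (β : ℕ) + (γ : ℕ) + (τ : ℕ)) *
              (∑ a, ∑ c,
                  (x (a, γ) * x (c, α) * partialD2 G a τ c β x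
                    - x (a, γ) * x (c, β) * partialD2 G a τ c α x
                    - x (a, τ) * x (c, α) * partialD2 G a γ c β x
                    + x (a, τ) * x (c, β) * partialD2 G a γ c α x)
                - ∑ i, ∑ s, x (s, i) *
                    (x (s, τ) * x (s, β) * kron γ α - x (s, γ) * x (s, β) * kron τ α
                      - x (s, τ) * x (s, α) * kron γ β + x (s, γ) * x (s, α) * kron τ β)
                    * partialD G s i x
                - 1 / 2 * ∑ pq : UpperPair n, ∑ i,
                    (x (pq.1.2, i) * partialD G pq.1.1 i x + x (pq.1.1, i) * partialD G pq.1.2 i x)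
                    * (x (pq.1.1, τ) * x (pq.1.2, β) * kron γ α
                      - x (pq.1.1, γ) * x (pq.1.2, β) * kron τ α
                      - x (pq.1.1, τ) * x (pq.1.2, α) * kron γ β
                      + x (pq.1.1, γ) * x (pq.1.2, α) * kron τ β
                      + x (pq.1.2, τ) * x (pq.1.1, β) * kron γ α
                      - x (pq.1.2, γ) * x (pq.1.1, β) * kron τ α
                      - x (pq.1.2, τ) * x (pq.1.1, α) * kron γ β
                      + x (pq.1.2, γ) * x (pq.1.1, α) * kron τ β)) := by
  have hfG := eqOn_onOrthSet hgG
  refine ⟨orthSet_eq_levelSet, fun x hx => linearIndependent_gradient_constraints hx,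
    isLeviCivita_covDeriv contDiff_constraints fun y hy => mem_tangentSpaceAt_orthSet hy,
    fun x hx => ?_⟩
  refine ⟨(hG.differentiable two_ne_zero x).differentiableWithinAt.congr hfG (hfG hx),
    differentiableWithinAt_riemGradient contDiff_constraints
      (fun y hy => mem_tangentSpaceAt_orthSet hy) hG hfG gradNormSq_ne_zero
      (fun y hy => gramian_constraints hy) hx, ?_, multiplier_normConstraint G hx,
    multiplier_innerConstraint G hx, hessianForm_orthSet hG hfG hx, fun η ξ => ?_,
    fun α β _ => tangentVec_eq_sum x α β, tangentBasis hx, coe_tangentBasis hx,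
    fun γ τ α β hγτ hαβ => ?_⟩
  · rw [gramian_constraints hx, Matrix.det_diagonal]
    exact Finset.prod_ne_zero_iff.2 fun i _ => gradNormSq_ne_zero i
  · rw [hessianForm_orthSet hG hfG hx, ambientHessian_eq_sum hG]
    simp only [ambientHessian_normConstraint, ambientHessian_innerConstraint,
      inner_partialRow_rowVec, inner_rowVec, ← Finset.sum_add_distrib, Finset.sum_mul_sum]
    congr 2
    · rw [Finset.sum_comm]
      refine Finset.sum_congr rfl fun i _ => ?_
      rw [Finset.sum_comm]
    · refine Finset.sum_congr rfl fun pq _ => Finset.sum_congr rfl fun i _ =>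
        Finset.sum_congr rfl fun j _ => ?_
      rw [add_comm ((η : EucMat n) (pq.1.2, j) * _)]
  · rw [hessianForm_orthSet hG hfG hx, coe_tangentBasis, coe_tangentBasis,
      ambientHessian_tangentVec hG]
    simp only [ambientHessian_normConstraint, ambientHessian_innerConstraint,
      inner_partialRow_rowVec, inner_rowVec_tangentVec, mul_sub, Finset.mul_sum, Finset.sum_mul,
      ← Finset.sum_add_distrib]
    refine congrArg₂ (· - ·) (congrArg₂ (· - ·) rfl ?_) ?_
    · rw [Finset.sum_comm]
      refine Finset.sum_congr rfl fun i _ => Finset.sum_congr rfl fun s _ => ?_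
      ring
    · refine Finset.sum_congr rfl fun pq _ => Finset.sum_congr rfl fun i _ => ?_
      ring
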